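/- **Setting.** Let $m\ge 0$ and $n\ge 2m+1$ be integers. A *fundamental set* of type $(2m+1,n)$ is a nonempty family $\mathcal E$ of subsets of $\{1,\dots,n\}$, all of cardinality $2m+1$. A subset of $\{1,\dots,n\}$ is *acceptable* if it contains an element of $\mathcal E$, and an index is *indispensable* if it belongs to every element of $\mathcal E$; $\mathcal E$ has type $(2m+1,n,k)$ if it has exactly $k$ indispensable indices. Put $I_z=\{i : z_i\neq 0\}$ for $z\in\mathbb C^n$ and $\mathcal S=\{z\in\mathbb C^n : I_z \text{ is acceptable}\}$, an open subset of $\mathbb C^n$. Let $l=(l_1,\dots,l_n)$ be a family of vectors of $\mathbb C^m$ such that for every $P\in\mathcal E$ the vectors $l_p$, $p\in P$, span $\mathbb C^m$ as a real affine space. The group $\mathbb C^*\times\mathbb C^m$ acts on $\mathcal S$ by $$(\alpha,T)\cdot z=(\alpha e^{\langle l_1,T\rangle}z_1,\dots,\alpha e^{\langle l_n,T\rangle}z_n),\qquad \langle v,T\rangle=\sum_{r=1}^m v_rT_r ;$$ let $\mathcal N$ be the orbit space with the quotient topology. The system $(\mathcal E,l)$ is *good* if $\mathcal N$ is compact and Hausdorff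 and can be endowed with a structure of complex manifold for which the natural projection $\mathcal S\to\mathcal N$ is holomorphic; $\mathcal N$ is then called an LVMB manifold. The *associated complex* $\mathcal P$ is the simplicial complex on $\{1,\dots,n\}$ whose simplices are the sets with acceptable complement. For a simplicial complex $K$ on $\{1,\dots,p\}$ (containing $\emptyset$; not every index need be a vertex), the *moment-angle complex* is $$\mathcal Z_{K,p}=\bigcup_{\sigma\in K}\{z\in\mathbb C^p : |z_i|\le 1\ \ \forall i,\ \ |z_i|=1\ \ \forall i\notin\sigma\}.$$ One has $\mathcal Z_{\mathcal P,n}\subset\mathcal S$, and $S^1$ acts diagonally on $\mathcal Z_{\mathcal P,n}$ by $u\cdot z=(uz_1,\dots,uz_n)$. **Proposition 5.2.** Let $(\mathcal E,l)$ be a good system of type $(2m+1,n,k)$ with $k>0$. Then an indispensable index exists, and for every indispensable index $j$ and every enumeration $e:\{1,\dots,n-1\}\to\{1,\dots,n\}\setminus\{j\}$ (a bijection), view $\mathcal P$ as a complex on $\{1,\dots,n-1\}$ through $e$ (no simplex of $\mathcal P$ contains $j$). Then: 1. the inclusion $\mathcal Z_{\mathcal P,n}\subset\mathcal S$ induces a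 homeomorphism $\mathcal Z_{\mathcal P,n}/S^1\to\mathcal N$; 2. there is a homeomorphism $\mathcal N\to\mathcal Z_{\mathcal P,n-1}$ which sends the class of each $z\in\mathcal Z_{\mathcal P,n}$ to $$\left(\frac{z_{e(1)}}{z_j},\dots,\frac{z_{e(n-1)}}{z_j}\right).$$ In particular, if $n$ is indispensable, $\mathcal N$ is homeomorphic to $\mathcal Z_{\mathcal P,n-1}$ through $z\mapsto(z_1/z_n,\dots,z_{n-1}/z_n)$. -/

import Mathlib

open scoped Manifold ContDiff

namespace LVMB

/-- A fundamental set of type `(M, n)`: a nonempty family of subsets of an `n`-element set, all of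
cardinality `M`. -/
structure FundamentalSet (M n : ℕ) where
  /-- The fundamental subsets. -/
  sets : Set (Finset (Fin n))
  nonempty : sets.Nonempty
  card_eq : ∀ P ∈ sets, P.card = M

namespace FundamentalSet

variable {M n : ℕ} (E : FundamentalSet M n)

/-- A set of indices is acceptable if it contains a fundamental subset. -/
def Acceptable (Q : Finset (Fin n)) : Prop := ∃ P ∈ E.sets, P ⊆ Q

/-- The indispensable indices: those lying in every fundamental subset. -/
def indispensable : Set (Fin n) := {j | ∀ P ∈ E.sets, j ∈ P}

end FundamentalSet

/-- An abstract simplicial complex on `{1, …, n}`. The empty simplex always belongs to it, and the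
indices need not all be vertices. -/
structure SimplicialComplexOn (n : ℕ) where
  /-- The simplices. -/
  faces : Set (Finset (Fin n))
  empty_mem : ∅ ∈ faces
  down_closed : ∀ σ ∈ faces, ∀ τ ⊆ σ, τ ∈ faces

/-- The complex seen on a smaller index set: `K` restricted to the image of the injection `f`,
with the indices relabelled through `f`. -/
def SimplicialComplexOn.comap {p n : ℕ} (K : SimplicialComplexOn n) (f : Fin p ↪ Fin n) :
    SimplicialComplexOn p where
  faces := {σ | σ.map f ∈ K.faces}
  empty_mem := by simpa using K.empty_mem
  down_closed := fun σ hσ τ hτ => K.down_closed _ hσ _ (Finset.map_subset_map.2 hτ)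

/-- The complex associated to a fundamental set: the sets of indices whose complement is
acceptable. -/
def FundamentalSet.associatedComplex {M n : ℕ} (E : FundamentalSet M n) :
    SimplicialComplexOn n where
  faces := {σ | E.Acceptable σᶜ}
  empty_mem := by
    obtain ⟨P, hP⟩ := E.nonempty
    exact ⟨P, hP, by simp⟩
  down_closed := by
    rintro σ ⟨P, hP, hPσ⟩ τ hτ
    exact ⟨P, hP, hPσ.trans (Finset.compl_subset_compl.2 hτ)⟩

/-! ### Moment-angle complexes -/

/-- The block `B_σ` of the closed unit polydisc: `|z_j| ≤ 1` for all `j`, and `|z_j| = 1` for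
`j ∉ σ`. -/
def block {n : ℕ} (σ : Finset (Fin n)) : Set (Fin n → ℂ) :=
  {z | (∀ j, ‖z j‖ ≤ 1) ∧ ∀ j, j ∉ σ → ‖z j‖ = 1}

/-- The moment-angle complex `Z_{K,n} ⊆ ℂⁿ` of a simplicial complex `K` on `{1, …, n}`. -/
def momentAngle {n : ℕ} (K : SimplicialComplexOn n) : Set (Fin n → ℂ) :=
  ⋃ σ ∈ K.faces, block σ

/-- The orbit relation of the diagonal action of `S¹` on a moment-angle complex. -/
def diagonalSetoid {n : ℕ} (K : SimplicialComplexOn n) : Setoid (momentAngle K) where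
  r z w := ∃ u : Circle, ∀ i, w.1 i = (u : ℂ) * z.1 i
  iseqv :=
    { refl := fun z => ⟨1, fun i => by simp⟩
      symm := by
        rintro z w ⟨u, hu⟩
        refine ⟨u⁻¹, fun i => ?_⟩
        rw [hu i, Circle.coe_inv, inv_mul_cancel_left₀ u.coe_ne_zero]
      trans := by
        rintro x y z ⟨u, hu⟩ ⟨v, hv⟩
        exact ⟨v * u, fun i => by rw [hv i, hu i, Circle.coe_mul, mul_assoc]⟩ }

/-- The quotient of a moment-angle complex by the diagonal circle action, with the quotient
topology. -/
abbrev DiagonalQuotient {n : ℕ} (K : SimplicialComplexOn n) : Type :=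
  Quotient (diagonalSetoid K)

/-! ### The open set `S` and the orbit space `N` -/

open Classical in
/-- The support `I_z`: the indices of the nonzero coordinates. -/
noncomputable def supp {n : ℕ} (z : Fin n → ℂ) : Finset (Fin n) :=
  Finset.univ.filter fun i => z i ≠ 0

/-- The open set `S ⊆ ℂⁿ` of the points whose support is acceptable. -/
def FundamentalSet.domain {M n : ℕ} (E : FundamentalSet M n) :
    TopologicalSpace.Opens (Fin n → ℂ) where
  carrier := {z | E.Acceptable (supp z)}
  is_open' := by
    have h : {z : Fin n → ℂ | E.Acceptable (supp z)} =
        ⋃ P ∈ E.sets, ⋂ i ∈ P, {z : Fin n → ℂ | z i ≠ 0} := by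
      ext z
      simp [FundamentalSet.Acceptable, supp, Finset.subset_iff]
    rw [h]
    refine isOpen_biUnion fun P _ => isOpen_biInter_finset fun i _ => ?_
    exact isOpen_ne_fun (continuous_apply i) continuous_const

/-- The holomorphic action of `(α, T) ∈ ℂ* × ℂᵐ` on `ℂⁿ` defined by a family `l` of vectors of
`ℂᵐ`; the pairing `⟨l_i, T⟩ = ∑ l_{i,r} T_r` is bilinear (not Hermitian). -/
noncomputable def act {m n : ℕ} (l : Fin n → Fin m → ℂ) (α : ℂˣ) (T : Fin m → ℂ)
    (z : Fin n → ℂ) : Fin n → ℂ :=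
  fun i => (α : ℂ) * Complex.exp (l i ⬝ᵥ T) * z i

/-- The orbit relation of the holomorphic action restricted to `S`. -/
def orbitSetoid {M m n : ℕ} (E : FundamentalSet M n) (l : Fin n → Fin m → ℂ) :
    Setoid E.domain where
  r z w := ∃ (α : ℂˣ) (T : Fin m → ℂ), w.1 = act l α T z.1
  iseqv :=
    { refl := fun z => ⟨1, 0, by ext i; simp [act]⟩
      symm := by
        rintro z w ⟨α, T, h⟩
        refine ⟨α⁻¹, -T, ?_⟩
        ext i
        have hα : (α : ℂ) ≠ 0 := α.ne_zero
        have he : Complex.exp (l i ⬝ᵥ T) ≠ 0 := Complex.exp_ne_zero _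
        rw [h]
        simp only [act, dotProduct_neg, Complex.exp_neg, Units.val_inv_eq_inv_val]
        field_simp
      trans := by
        rintro x y z ⟨α, T, h⟩ ⟨β, R, h'⟩
        refine ⟨β * α, R + T, ?_⟩
        ext i
        rw [h', h]
        simp only [act, dotProduct_add, Complex.exp_add, Units.val_mul]
        ring }

/-- The orbit space `N` of the holomorphic action on `S`, with the quotient topology. -/
abbrev OrbitSpace {M m n : ℕ} (E : FundamentalSet M n) (l : Fin n → Fin m → ℂ) : Type :=
  Quotient (orbitSetoid E l)

/-- The natural projection `S → N`. -/
def proj {M m n : ℕ} (E : FundamentalSet M n) (l : Fin n → Fin m → ℂ) :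
    E.domain → OrbitSpace E l :=
  Quotient.mk (orbitSetoid E l)

/-- The system `(E, l)` is acceptable: for every fundamental subset `P`, the vectors `l_p`,
`p ∈ P`, span `ℂᵐ` as a real affine space. -/
def IsAcceptableSystem {m n : ℕ} (E : FundamentalSet (2 * m + 1) n)
    (l : Fin n → Fin m → ℂ) : Prop :=
  ∀ P ∈ E.sets, affineSpan ℝ (l '' (P : Set (Fin n))) = ⊤

/-- The acceptable system `(E, l)` is good: its orbit space is a compact complex manifold
(compact, Hausdorff, with an atlas of complex charts with holomorphic changes of coordinates) for
a structure that makes the natural projection holomorphic. The charts are homeomorphisms for the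
quotient topology of the orbit space. -/
structure IsGoodSystem {m n : ℕ} (E : FundamentalSet (2 * m + 1) n)
    (l : Fin n → Fin m → ℂ) : Prop where
  acceptable : IsAcceptableSystem E l
  compact : CompactSpace (OrbitSpace E l)
  hausdorff : T2Space (OrbitSpace E l)
  complex : ∃ (d : ℕ) (_ : ChartedSpace (EuclideanSpace ℂ (Fin d)) (OrbitSpace E l)),
    IsManifold 𝓘(ℂ, EuclideanSpace ℂ (Fin d)) ω (OrbitSpace E l) ∧
    MDifferentiable 𝓘(ℂ, Fin n → ℂ) 𝓘(ℂ, EuclideanSpace ℂ (Fin d)) (proj E l)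

/-- The moment-angle complex of the associated complex is contained in `S`. -/
theorem momentAngle_subset_domain {M n : ℕ} (E : FundamentalSet M n) {z : Fin n → ℂ}
    (hz : z ∈ momentAngle E.associatedComplex) : z ∈ E.domain := by
  simp only [momentAngle, Set.mem_iUnion] at hz
  obtain ⟨σ, ⟨P, hP, hPσ⟩, -, hσ⟩ := hz
  refine ⟨P, hP, fun i hi => ?_⟩
  have h1 : ‖z i‖ = 1 := hσ i (Finset.mem_compl.1 (hPσ hi))
  simp only [supp, Finset.mem_filter, Finset.mem_univ, true_and]
  intro h0
  simp [h0] at h1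

/-- The inclusion of the moment-angle complex `Z_{P,n}` of the associated complex in `S`. -/
def incl {M n : ℕ} (E : FundamentalSet M n) (z : momentAngle E.associatedComplex) : E.domain :=
  ⟨z.1, momentAngle_subset_domain E z.2⟩

end LVMB

open Filter Topology

namespace LVMB

/-! ### Compactness and coordinates of moment-angle complexes -/

section MomentAngle

variable {n : ℕ}

/-! The moment-angle complex is a slice for the action modulo the diagonal circle: each orbit in the
domain meets it in exactly one circle orbit. Both halves come from a rescaling argument. Replace a
point by the powers `|z_i| ^ (k + 1)` of its moduli and let `k` grow; topological properties of the
orbit space then control exponential rates.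

The Hausdorff property gives uniqueness (`norm_eq_one_and_eq_zero_of_act_mem`): two sequences lying
in the same orbits have limits in the same orbit, hence with equal supports. Compactness gives
existence (`exists_act_mem_momentAngle`): group elements that bring the powers back near a point of
the domain, divided by the power, converge to the normalizing element. In both, the spanning
condition, through `exponent_injective`, recovers a group element up to rotation from its moduli on
one fundamental subset.

Continuous bijections from compact spaces to Hausdorff spaces then give both homeomorphisms. For the
second, an indispensable coordinate has modulus one on the whole complex, so dividing by it selects
one point per circle orbit. -/

lemma isClosed_block (σ : Finset (Fin n)) : IsClosed (block σ) := by
  have h : block σ = (⋂ j, {z : Fin n → ℂ | ‖z j‖ ≤ 1}) ∩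
      ⋂ j, ⋂ (_ : j ∉ σ), {z : Fin n → ℂ | ‖z j‖ = 1} := by
    ext z
    simp [block]
  rw [h]
  refine (isClosed_iInter fun j => isClosed_le (by fun_prop) continuous_const).inter
    (isClosed_iInter fun j => isClosed_iInter fun _ => isClosed_eq (by fun_prop) continuous_const)

lemma norm_apply_le_of_mem_momentAngle {K : SimplicialComplexOn n} {z : Fin n → ℂ}
    (hz : z ∈ momentAngle K) (i : Fin n) : ‖z i‖ ≤ 1 := by
  simp only [momentAngle, Set.mem_iUnion] at hz
  obtain ⟨σ, -, h, -⟩ := hz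
  exact h i

lemma isCompact_momentAngle (K : SimplicialComplexOn n) : IsCompact (momentAngle K) := by
  refine (isCompact_closedBall (0 : Fin n → ℂ) 1).of_isClosed_subset
    ((Set.toFinite K.faces).isClosed_biUnion fun σ _ => isClosed_block σ) fun z hz => ?_
  rw [mem_closedBall_zero_iff, pi_norm_le_iff_of_nonneg zero_le_one]
  exact norm_apply_le_of_mem_momentAngle hz

instance compactSpace_momentAngle (K : SimplicialComplexOn n) : CompactSpace (momentAngle K) :=
  isCompact_iff_compactSpace.1 (isCompact_momentAngle K)

lemma mem_momentAngle_iff {M : ℕ} (E : FundamentalSet M n) (z : Fin n → ℂ) :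
    z ∈ momentAngle E.associatedComplex ↔
      (∀ i, ‖z i‖ ≤ 1) ∧ ∃ P ∈ E.sets, ∀ i ∈ P, ‖z i‖ = 1 := by
  simp only [momentAngle, Set.mem_iUnion]
  constructor
  · rintro ⟨σ, ⟨P, hP, hPσ⟩, h1, h2⟩
    exact ⟨h1, P, hP, fun i hi => h2 i (Finset.mem_compl.1 (hPσ hi))⟩
  · rintro ⟨h1, P, hP, h2⟩
    exact ⟨Pᶜ, ⟨P, hP, by simp⟩, h1, fun i hi => h2 i (by simpa using hi)⟩

end MomentAngle

/-! ### The action, its quotient map and powers of moduli -/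

section Action

variable {M m n : ℕ} {E : FundamentalSet M n} {l : Fin n → Fin m → ℂ}

lemma mem_domain_iff {z : Fin n → ℂ} : z ∈ E.domain ↔ ∃ P ∈ E.sets, ∀ i ∈ P, z i ≠ 0 := by
  change E.Acceptable (supp z) ↔ _
  simp [FundamentalSet.Acceptable, supp, Finset.subset_iff]

lemma act_apply_ne_zero_iff (α : ℂˣ) (T : Fin m → ℂ) (z : Fin n → ℂ) (i : Fin n) :
    act l α T z i ≠ 0 ↔ z i ≠ 0 := by
  simp [act]

lemma act_mem_domain (α : ℂˣ) (T : Fin m → ℂ) {z : Fin n → ℂ} (hz : z ∈ E.domain) :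
    act l α T z ∈ E.domain := by
  simpa only [mem_domain_iff, act_apply_ne_zero_iff] using hz

lemma continuous_act (α : ℂˣ) (T : Fin m → ℂ) : Continuous (act l α T) := by
  unfold act
  fun_prop

lemma norm_act_apply (α : ℂˣ) (T : Fin m → ℂ) (z : Fin n → ℂ) (i : Fin n) :
    ‖act l α T z i‖ = Real.exp (Real.log ‖(α : ℂ)‖ + (l i ⬝ᵥ T).re) * ‖z i‖ := by
  rw [act, norm_mul, norm_mul, Complex.norm_exp, Real.exp_add,
    Real.exp_log (norm_pos_iff.2 α.ne_zero)]

lemma proj_eq_iff {z w : E.domain} :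
    proj E l z = proj E l w ↔ ∃ (α : ℂˣ) (T : Fin m → ℂ), w.1 = act l α T z.1 :=
  Quotient.eq (r := orbitSetoid E l)

lemma continuous_proj : Continuous (proj E l) := continuous_quotient_mk'

lemma isOpenMap_proj : IsOpenMap (proj E l) := by
  intro U hU
  -- The saturation of `U` is a union of preimages of `U` under group elements, which act
  -- continuously.
  have h : proj E l ⁻¹' (proj E l '' U) = ⋃ (α : ℂˣ) (T : Fin m → ℂ),
      (fun z : E.domain => (⟨act l α T z.1, act_mem_domain α T z.2⟩ : E.domain)) ⁻¹' U := by
    ext z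
    simp only [Set.mem_preimage, Set.mem_image, Set.mem_iUnion]
    constructor
    · rintro ⟨w, hw, hwz⟩
      obtain ⟨α, T, h⟩ := proj_eq_iff.1 hwz.symm
      exact ⟨α, T, by simpa only [← h] using hw⟩
    · rintro ⟨α, T, h⟩
      exact ⟨_, h, (proj_eq_iff.2 ⟨α, T, rfl⟩).symm⟩
  rw [← isQuotientMap_quotient_mk'.isOpen_preimage] at *
  change IsOpen (proj E l ⁻¹' (proj E l '' U))
  rw [h]
  exact isOpen_iUnion fun α => isOpen_iUnion fun T =>
    hU.preimage (((continuous_act α T).comp continuous_subtype_val).subtype_mk _)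

/-- The powers of the moduli of the coordinates of a point. -/
noncomputable def normPow (z : Fin n → ℂ) (k : ℕ) : Fin n → ℂ := fun i => ((‖z i‖ ^ (k + 1) : ℝ) : ℂ)

lemma norm_normPow (z : Fin n → ℂ) (k : ℕ) (i : Fin n) : ‖normPow z k i‖ = ‖z i‖ ^ (k + 1) := by
  simp [normPow]

lemma normPow_mem_domain {z : Fin n → ℂ} (hz : z ∈ E.domain) (k : ℕ) :
    normPow z k ∈ E.domain := by
  obtain ⟨P, hP, h⟩ := mem_domain_iff.1 hz
  exact mem_domain_iff.2 ⟨P, hP, fun i hi => by simpa [normPow] using h i hi⟩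

end Action

/-- The real linear map sending `(a, T)` to the family of the exponents `a + Re ⟨l_i, T⟩` by which
the action rescales the coordinates with index in `P`. -/
noncomputable def exponent {m n : ℕ} (l : Fin n → Fin m → ℂ) (P : Finset (Fin n)) :
    ℝ × (Fin m → ℂ) →ₗ[ℝ] (P → ℝ) where
  toFun u i := u.1 + (l i ⬝ᵥ u.2).re
  map_add' u v := by
    ext i
    simp [dotProduct_add]
    ring
  map_smul' c u := by
    ext i
    simp [dotProduct_smul]
    ring

/-- A real affine function of `v`, namely `a + Re ⟨v, T⟩`, that vanishes on an affinely spanning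
family vanishes everywhere. Evaluating at `0` gives `a = 0`, and at the conjugate of `T` gives `∑
|T_r|² = 0`. -/
lemma exponent_injective {m n : ℕ} {l : Fin n → Fin m → ℂ} {P : Finset (Fin n)}
    (hP : affineSpan ℝ (l '' (P : Set (Fin n))) = ⊤) : Function.Injective (exponent l P) := by
  rw [injective_iff_map_eq_zero]
  rintro ⟨a, T⟩ h
  have key : ∀ v : Fin m → ℂ, a + (v ⬝ᵥ T).re = 0 := by
    intro v
    have hv : v ∈ affineSpan ℝ (l '' (P : Set (Fin n))) := by simp [hP]
    refine affineSpan_induction (p := fun v => a + (v ⬝ᵥ T).re = 0) hv ?_ ?_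
    · rintro _ ⟨i, hi, rfl⟩
      exact congrFun h ⟨i, hi⟩
    · intro c u v w hu hv hw
      simp only [vsub_eq_sub, vadd_eq_add, add_dotProduct, smul_dotProduct, sub_dotProduct,
        Complex.add_re, Complex.smul_re, Complex.sub_re, smul_eq_mul]
      linear_combination c * hu - c * hv + hw
  have ha : a = 0 := by simpa using key 0
  have hT : ∑ r, Complex.normSq (T r) = 0 := by
    have := key (star T)
    simpa [ha, dotProduct, Complex.re_sum, Complex.normSq_apply] using this
  rw [Finset.sum_eq_zero_iff_of_nonneg fun r _ => Complex.normSq_nonneg _] at hT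
  refine Prod.ext ha (funext fun r => ?_)
  simpa using hT r (Finset.mem_univ r)

/-! ### Each orbit meets the moment-angle complex in one circle orbit -/

section Orbits

variable {m n : ℕ} {E : FundamentalSet (2 * m + 1) n} {l : Fin n → Fin m → ℂ}

lemma tendsto_pow_succ_ite {x : ℝ} (h0 : 0 ≤ x) (h1 : x ≤ 1) :
    Tendsto (fun k : ℕ => x ^ (k + 1)) atTop (𝓝 (if x = 1 then 1 else 0)) := by
  split_ifs with h
  · simp [h]
  · exact (tendsto_pow_atTop_nhds_zero_of_lt_one h0 (lt_of_le_of_ne h1 h)).comp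
      (tendsto_add_atTop_nat 1)

/-- If the orbit space is Hausdorff, an element of the group that maps a point of the moment-angle
complex to a point of the moment-angle complex is a rotation. -/
lemma norm_eq_one_and_eq_zero_of_act_mem (hE : IsAcceptableSystem E l) [T2Space (OrbitSpace E l)]
    {z : Fin n → ℂ} (hz : z ∈ momentAngle E.associatedComplex) {α : ℂˣ} {T : Fin m → ℂ}
    (hw : act l α T z ∈ momentAngle E.associatedComplex) : ‖(α : ℂ)‖ = 1 ∧ T = 0 := by
  set w := act l α T z with hw_def
  obtain ⟨hz1, P, hP, hzP⟩ := (mem_momentAngle_iff E z).1 hz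
  obtain ⟨hw1, Q, hQ, hwQ⟩ := (mem_momentAngle_iff E w).1 hw
  -- With parameters `|α| ^ (k + 1)` and `(k + 1) T`, the moduli of the translated powers are `|w_i|
  -- ^ (k + 1)`.
  let β : ℕ → ℂˣ := fun k => Units.mk0 ((‖(α : ℂ)‖ : ℂ) ^ (k + 1)) (by simp)
  let p : ℕ → E.domain := fun k => ⟨normPow z k, normPow_mem_domain (momentAngle_subset_domain E hz) k⟩
  let q : ℕ → E.domain := fun k =>
    ⟨act l (β k) (((k + 1 : ℕ) : ℂ) • T) (p k).1, act_mem_domain _ _ (p k).2⟩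
  have hq : ∀ k i, ‖(q k).1 i‖ = ‖w i‖ ^ (k + 1) := by
    intro k i
    change ‖act l (β k) (((k + 1 : ℕ) : ℂ) • T) (normPow z k) i‖ = _
    simp only [hw_def, act, norm_mul, norm_normPow, dotProduct_smul, smul_eq_mul,
      Complex.exp_nat_mul, norm_pow, mul_pow, β, Units.val_mk0, Complex.norm_real, norm_norm]
  -- The moduli converge by themselves; the subsequence is needed for the arguments.
  obtain ⟨q', -, φ, hφ, hqlim⟩ := (isCompact_closedBall (0 : Fin n → ℂ) 1).tendsto_subseq
    (x := fun k => (q k).1) fun k => by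
      rw [mem_closedBall_zero_iff, pi_norm_le_iff_of_nonneg zero_le_one]
      exact fun i => (hq k i).le.trans (pow_le_one₀ (norm_nonneg _) (hw1 i))
  have hq'norm : ∀ i, ‖q' i‖ = if ‖w i‖ = 1 then 1 else 0 := by
    intro i
    refine tendsto_nhds_unique ((tendsto_pi_nhds.1 hqlim i).norm) ?_
    simp only [Function.comp_apply, hq]
    exact (tendsto_pow_succ_ite (norm_nonneg _) (hw1 i)).comp hφ.tendsto_atTop
  let p' : Fin n → ℂ := fun i => ((if ‖z i‖ = 1 then 1 else 0 : ℝ) : ℂ)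
  have hplim : Tendsto (fun k => (p k).1) atTop (𝓝 p') := by
    refine tendsto_pi_nhds.2 fun i => ?_
    exact (Complex.continuous_ofReal.tendsto _).comp
      (tendsto_pow_succ_ite (norm_nonneg _) (hz1 i))
  have hp'mem : p' ∈ E.domain :=
    mem_domain_iff.2 ⟨P, hP, fun i hi => by simp [p', hzP i hi]⟩
  have hq'mem : q' ∈ E.domain :=
    mem_domain_iff.2 ⟨Q, hQ, fun i hi => by rw [← norm_ne_zero_iff, hq'norm]; simp [hwQ i hi]⟩
  have hP' : Tendsto (p ∘ φ) atTop (𝓝 ⟨p', hp'mem⟩) :=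
    tendsto_subtype_rng.2 (hplim.comp hφ.tendsto_atTop)
  have hQ' : Tendsto (q ∘ φ) atTop (𝓝 ⟨q', hq'mem⟩) := tendsto_subtype_rng.2 hqlim
  have hproj : proj E l ∘ (p ∘ φ) = proj E l ∘ (q ∘ φ) :=
    funext fun k => proj_eq_iff.2 ⟨_, _, rfl⟩
  have hlim := ((continuous_proj (l := l)).tendsto _).comp hP'
  rw [hproj] at hlim
  obtain ⟨γ, R, hγ⟩ := proj_eq_iff.1
    (tendsto_nhds_unique hlim (((continuous_proj (l := l)).tendsto _).comp hQ'))
  -- The limits share an orbit, hence a support: `p'` is nonzero where `|z_i| = 1`, and `q'` where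
  -- `|w_i| = 1`.
  have hwP : ∀ i ∈ P, ‖w i‖ = 1 := by
    intro i hi
    have h1 : q' i ≠ 0 := by
      change q' = act l γ R p' at hγ
      rw [hγ, act_apply_ne_zero_iff]
      simp [p', hzP i hi]
    rw [← norm_ne_zero_iff, hq'norm] at h1
    by_contra h
    simp [h] at h1
  have h0 : (Real.log ‖(α : ℂ)‖, T) = (0 : ℝ × (Fin m → ℂ)) := by
    refine exponent_injective (hE P hP) ?_
    rw [map_zero]
    ext ⟨i, hi⟩
    have := hwP i hi
    rw [hw_def, norm_act_apply, hzP i hi, mul_one, Real.exp_eq_one_iff] at this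
    exact this
  rw [Prod.mk_eq_zero] at h0
  refine ⟨?_, h0.2⟩
  rw [← Real.exp_log (norm_pos_iff.2 α.ne_zero), h0.1, Real.exp_zero]

/-- A sequence in the acceptable domain has, up to the action and up to passing to a subsequence, a
limit in the domain, as soon as the orbit space is compact. -/
lemma exists_tendsto_act [CompactSpace (OrbitSpace E l)] (p : ℕ → E.domain) :
    ∃ s : E.domain, ∃ (φ : ℕ → ℕ) (α : ℕ → ℂˣ) (T : ℕ → Fin m → ℂ), Tendsto φ atTop atTop ∧
      Tendsto (fun k => act l (α k) (T k) (p (φ k)).1) atTop (𝓝 s.1) := by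
  obtain ⟨c, hc⟩ := exists_clusterPt_of_compactSpace (map (fun k => proj E l (p k)) atTop)
  obtain ⟨s, rfl⟩ := Quotient.exists_rep c
  have h : ∀ j : ℕ, ∃ k, j ≤ k ∧ ∃ (α : ℂˣ) (T : Fin m → ℂ),
      dist (act l α T (p k).1) s.1 < 1 / ((j : ℝ) + 1) := by
    intro j
    -- Openness of the projection lifts the cluster point: orbits near that of `s` pass near `s`
    -- itself.
    have hU : proj E l '' Metric.ball s (1 / ((j : ℝ) + 1)) ∈ 𝓝 (proj E l s) :=
      isOpenMap_proj.image_mem_nhds (Metric.ball_mem_nhds s (by positivity))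
    obtain ⟨k, hjk, w, hw, hwk⟩ := frequently_atTop.1 (MapClusterPt.frequently hc hU) j
    obtain ⟨α, T, hα⟩ := proj_eq_iff.1 hwk.symm
    exact ⟨k, hjk, α, T, by rw [← hα]; exact hw⟩
  choose φ hφ α T hd using h
  refine ⟨s, φ, α, T, tendsto_atTop_mono hφ tendsto_id, ?_⟩
  rw [tendsto_iff_dist_tendsto_zero]
  exact squeeze_zero (fun _ => dist_nonneg) (fun j => (hd j).le)
    tendsto_one_div_add_atTop_nhds_zero_nat

/-- If the orbit space is compact, every orbit meets the moment-angle complex. -/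
lemma exists_act_mem_momentAngle (hE : IsAcceptableSystem E l) [CompactSpace (OrbitSpace E l)]
    {z : Fin n → ℂ} (hz : z ∈ E.domain) :
    ∃ (α : ℂˣ) (T : Fin m → ℂ), act l α T z ∈ momentAngle E.associatedComplex := by
  obtain ⟨⟨s, hs⟩, φ, α, T, hφ, hlim⟩ :=
    exists_tendsto_act (E := E) (l := l) fun k => ⟨normPow z k, normPow_mem_domain hz k⟩
  simp only at hlim
  set q : ℕ → Fin n → ℂ := fun k => act l (α k) (T k) (normPow z (φ k)) with hq
  obtain ⟨P, hP, hsP⟩ := mem_domain_iff.1 hs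
  let N : ℕ → ℝ := fun k => ((φ k : ℝ) + 1)
  have hN : ∀ k, 0 < N k := fun k => by positivity
  have hNlim : Tendsto N atTop atTop :=
    tendsto_atTop_add_const_right _ _ (tendsto_natCast_atTop_atTop.comp hφ)
  -- Dividing by the power `N k` makes the exponents on `P` tend to `-log |z_i|`, since `log |q k
  -- i|` stays bounded there.
  let u : ℕ → ℝ × (Fin m → ℂ) := fun k => (N k)⁻¹ • (Real.log ‖(α k : ℂ)‖, T k)
  have hlog : ∀ k i, z i ≠ 0 → (u k).1 + (l i ⬝ᵥ (u k).2).re =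
      (N k)⁻¹ * Real.log ‖q k i‖ - Real.log ‖z i‖ := by
    intro k i hi
    have hi' : ‖z i‖ ≠ 0 := norm_ne_zero_iff.2 hi
    have h := (hN k).ne'
    simp only [hq, norm_act_apply, norm_normPow, u]
    rw [Real.log_mul (Real.exp_ne_zero _) (pow_ne_zero _ hi'), Real.log_exp, Real.log_pow]
    simp only [Prod.smul_mk, dotProduct_smul, Complex.smul_re, smul_eq_mul]
    field_simp
    simp only [N]
    push_cast
    ring
  -- A zero coordinate stays zero in every power, as `k + 1` is positive, so it would be zero in the
  -- limit `s`.
  have hzP : ∀ i ∈ P, z i ≠ 0 := by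
    intro i hi h0
    refine hsP i hi (tendsto_nhds_unique (tendsto_pi_nhds.1 hlim i) ?_)
    simp [hq, act, normPow, h0]
  have hexp : Tendsto (fun k => exponent l P (u k)) atTop
      (𝓝 fun i : P => - Real.log ‖z i‖) := by
    refine tendsto_pi_nhds.2 fun ⟨i, hi⟩ => ?_
    have h1 : Tendsto (fun k => (N k)⁻¹ * Real.log ‖q k i‖ - Real.log ‖z i‖) atTop
        (𝓝 (0 * Real.log ‖s i‖ - Real.log ‖z i‖)) :=
      (hNlim.inv_tendsto_atTop.mul ((tendsto_pi_nhds.1 hlim i).norm.log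
        (norm_ne_zero_iff.2 (hsP i hi)))).sub_const _
    rw [zero_mul, zero_sub] at h1
    exact h1.congr fun k => (hlog k i (hzP i hi)).symm
  have hemb : IsClosedEmbedding (exponent l P) :=
    LinearMap.isClosedEmbedding_of_injective (LinearMap.ker_eq_bot.2 (exponent_injective (hE P hP)))
  obtain ⟨⟨a, R⟩, hv⟩ := hemb.isClosed_range.mem_of_tendsto hexp
    (Eventually.of_forall fun k => ⟨u k, rfl⟩)
  rw [← hv] at hexp
  have hu : Tendsto u atTop (𝓝 (a, R)) := hemb.isInducing.tendsto_nhds_iff.2 hexp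
  have hnorm : ∀ i, ‖act l (Units.mk0 (Real.exp a : ℂ) (by simp)) R z i‖ =
      Real.exp (a + (l i ⬝ᵥ R).re) * ‖z i‖ := by
    intro i
    rw [norm_act_apply, Units.val_mk0, Complex.norm_real, Real.norm_eq_abs, Real.abs_exp,
      Real.log_exp]
  have hone : ∀ i ∈ P, Real.exp (a + (l i ⬝ᵥ R).re) * ‖z i‖ = 1 := by
    intro i hi
    have h : a + (l i ⬝ᵥ R).re = - Real.log ‖z i‖ := congrFun hv ⟨i, hi⟩
    have h0 := norm_pos_iff.2 (hzP i hi)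
    rw [h, Real.exp_neg, Real.exp_log h0, inv_mul_cancel₀ h0.ne']
  refine ⟨Units.mk0 (Real.exp a : ℂ) (by simp), R, (mem_momentAngle_iff E _).2
    ⟨fun i => ?_, P, hP, fun i hi => by rw [hnorm, hone i hi]⟩⟩
  rw [hnorm]
  by_cases hzi : z i = 0
  · simp [hzi]
  have hzi' := norm_pos_iff.2 hzi
  suffices h : a + (l i ⬝ᵥ R).re ≤ - Real.log ‖z i‖ by
    calc _ ≤ Real.exp (- Real.log ‖z i‖) * ‖z i‖ := by gcongr
      _ = 1 := by rw [Real.exp_neg, Real.exp_log hzi', inv_mul_cancel₀ hzi'.ne']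
  have hcont : Continuous fun v : ℝ × (Fin m → ℂ) => v.1 + (l i ⬝ᵥ v.2).re := by
    unfold dotProduct
    fun_prop
  have hle : Tendsto (fun k => (u k).1 + (l i ⬝ᵥ (u k).2).re) atTop
      (𝓝 (a + (l i ⬝ᵥ R).re)) := (hcont.tendsto (a, R)).comp hu
  -- If `s i = 0`, the logarithm may diverge to `-∞`, but its eventual sign suffices for the upper
  -- bound; otherwise it is bounded and equality holds.
  by_cases hsi : s i = 0
  · refine le_of_tendsto hle ?_
    have h0 := (tendsto_pi_nhds.1 hlim i).norm
    rw [hsi, norm_zero] at h0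
    filter_upwards [h0.eventually_le_const zero_lt_one] with k hk
    rw [hlog k i hzi]
    have h1 : (N k)⁻¹ * Real.log ‖q k i‖ ≤ 0 :=
      mul_nonpos_of_nonneg_of_nonpos (inv_nonneg.2 (hN k).le)
        (Real.log_nonpos (norm_nonneg _) hk)
    linarith
  · have h1 : Tendsto (fun k => (N k)⁻¹ * Real.log ‖q k i‖ - Real.log ‖z i‖) atTop
        (𝓝 (0 * Real.log ‖s i‖ - Real.log ‖z i‖)) :=
      (hNlim.inv_tendsto_atTop.mul ((tendsto_pi_nhds.1 hlim i).norm.log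
        (norm_ne_zero_iff.2 hsi))).sub_const _
    rw [zero_mul, zero_sub] at h1
    exact (tendsto_nhds_unique hle (h1.congr fun k => (hlog k i hzi).symm)).le

lemma continuous_incl : Continuous (incl E) :=
  continuous_subtype_val.subtype_mk _

lemma proj_incl_eq_iff (hE : IsAcceptableSystem E l) [T2Space (OrbitSpace E l)]
    (z w : momentAngle E.associatedComplex) :
    proj E l (incl E z) = proj E l (incl E w) ↔ diagonalSetoid E.associatedComplex z w := by
  rw [proj_eq_iff]
  constructor
  · rintro ⟨α, T, h⟩
    change w.1 = act l α T z.1 at h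
    obtain ⟨hα, rfl⟩ := norm_eq_one_and_eq_zero_of_act_mem hE z.2 (h ▸ w.2)
    exact ⟨⟨α, mem_sphere_zero_iff_norm.2 hα⟩, fun i => by simp [h, act]⟩
  · rintro ⟨u, hu⟩
    refine ⟨Units.mk0 u u.coe_ne_zero, 0, funext fun i => ?_⟩
    change w.1 i = act l _ _ z.1 i
    simp [act, hu]

/-- The homeomorphism from the quotient of the moment-angle complex by the diagonal circle onto a
compact Hausdorff orbit space, induced by the inclusion. -/
noncomputable def diagonalQuotientHomeomorph (hE : IsAcceptableSystem E l)
    [CompactSpace (OrbitSpace E l)] [T2Space (OrbitSpace E l)] :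
    DiagonalQuotient E.associatedComplex ≃ₜ OrbitSpace E l :=
  Continuous.homeoOfEquivCompactToT2
    (f := Equiv.ofBijective
      (Quotient.lift (fun z => proj E l (incl E z)) fun z w h => (proj_incl_eq_iff hE z w).2 h) <| by
        constructor
        · rintro ⟨z⟩ ⟨w⟩ h
          exact Quotient.sound ((proj_incl_eq_iff hE z w).1 h)
        · rintro ⟨z⟩
          obtain ⟨α, T, h⟩ := exists_act_mem_momentAngle hE z.2
          exact ⟨Quotient.mk _ ⟨_, h⟩, (proj_eq_iff.2 ⟨α, T, rfl⟩).symm⟩)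
    ((continuous_proj.comp continuous_incl).quotient_lift _)

end Orbits

/-! ### Normalizing an indispensable coordinate -/

section Quotients

variable {M n : ℕ} {E : FundamentalSet M n} {j : Fin n}

lemma norm_apply_eq_one_of_indispensable (hj : j ∈ E.indispensable) {z : Fin n → ℂ}
    (hz : z ∈ momentAngle E.associatedComplex) : ‖z j‖ = 1 := by
  obtain ⟨-, P, hP, h⟩ := (mem_momentAngle_iff E z).1 hz
  exact h j (hj P hP)

lemma apply_ne_zero_of_indispensable (hj : j ∈ E.indispensable) {z : Fin n → ℂ}
    (hz : z ∈ momentAngle E.associatedComplex) : z j ≠ 0 := by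
  rw [← norm_ne_zero_iff, norm_apply_eq_one_of_indispensable hj hz]
  exact one_ne_zero

variable {p : ℕ} (e : Fin p ≃ {i : Fin n // i ≠ j})

lemma div_mem_momentAngle_comap (hj : j ∈ E.indispensable) {z : Fin n → ℂ}
    (hz : z ∈ momentAngle E.associatedComplex) :
    (fun i => z (e i) / z j) ∈ momentAngle (E.associatedComplex.comap
      (e.toEmbedding.trans (Function.Embedding.subtype _))) := by
  have h1 := norm_apply_eq_one_of_indispensable hj hz
  simp only [momentAngle, Set.mem_iUnion] at hz ⊢
  obtain ⟨σ, hσ, h2, h3⟩ := hz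
  refine ⟨Finset.univ.filter fun i => (e i : Fin n) ∈ σ, ?_, fun i => ?_, fun i hi => ?_⟩
  · refine E.associatedComplex.down_closed σ hσ _ fun i hi => ?_
    obtain ⟨k, hk, rfl⟩ := Finset.mem_map.1 hi
    exact (Finset.mem_filter.1 hk).2
  · simpa [h1] using h2 (e i)
  · simpa [h1] using h3 (e i) (by simpa using hi)

open Classical in
-- Inserting `1` at `j` gives a section of the division map, hence its surjectivity.
lemma extend_mem_momentAngle {y : Fin p → ℂ}
    (hy : y ∈ momentAngle (E.associatedComplex.comap
      (e.toEmbedding.trans (Function.Embedding.subtype _)))) :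
    (fun i => if h : i ≠ j then y (e.symm ⟨i, h⟩) else 1) ∈ momentAngle E.associatedComplex := by
  simp only [momentAngle, Set.mem_iUnion] at hy ⊢
  obtain ⟨σ, hσ, h1, h2⟩ := hy
  refine ⟨_, hσ, fun i => ?_, fun i hi => ?_⟩
  · dsimp only
    split_ifs with h
    · exact h1 _
    · simp
  · dsimp only
    split_ifs with h
    · refine h2 _ fun hmem => hi (Finset.mem_map.2 ⟨_, hmem, ?_⟩)
      simp
    · simp

/-- Dividing by an indispensable coordinate identifies the quotient of the moment-angle complex by
the diagonal circle with the moment-angle complex on the remaining indices. -/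
noncomputable def diagonalQuotientHomeomorphComap (hj : j ∈ E.indispensable) :
    DiagonalQuotient E.associatedComplex ≃ₜ momentAngle (E.associatedComplex.comap
      (e.toEmbedding.trans (Function.Embedding.subtype _))) :=
  Continuous.homeoOfEquivCompactToT2
    (f := Equiv.ofBijective
      (Quotient.lift (fun z : momentAngle E.associatedComplex =>
          (⟨fun i => z.1 (e i) / z.1 j, div_mem_momentAngle_comap e hj z.2⟩ :
            momentAngle (E.associatedComplex.comap
              (e.toEmbedding.trans (Function.Embedding.subtype _))))) <| by
        rintro z w ⟨u, hu⟩
        refine Subtype.ext (funext fun i => ?_)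
        simp only [hu]
        rw [mul_div_mul_left _ _ u.coe_ne_zero]) <| by
      constructor
      · rintro ⟨z⟩ ⟨w⟩ h
        have hz := apply_ne_zero_of_indispensable hj z.2
        have hw := apply_ne_zero_of_indispensable hj w.2
        -- The coordinate `j` forces the rotation; equality of the quotients extends it to the other
        -- coordinates.
        refine Quotient.sound ⟨⟨w.1 j / z.1 j, mem_sphere_zero_iff_norm.2 ?_⟩, fun i => ?_⟩
        · simp [norm_apply_eq_one_of_indispensable hj z.2,
            norm_apply_eq_one_of_indispensable hj w.2]
        · change w.1 i = w.1 j / z.1 j * z.1 i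
          by_cases hi : i = j
          · subst hi
            field_simp
          · have := congrFun (congrArg Subtype.val h) (e.symm ⟨i, hi⟩)
            change z.1 (e _) / z.1 j = w.1 (e _) / w.1 j at this
            simp only [Equiv.apply_symm_apply] at this
            field_simp at this ⊢
            linear_combination -this
      · intro y
        refine ⟨Quotient.mk _ ⟨_, extend_mem_momentAngle e y.2⟩,
          Subtype.ext (funext fun i => ?_)⟩
        simp [(e i).2])
    (by
      refine Continuous.quotient_lift (Continuous.subtype_mk (continuous_pi fun i => ?_) _) _
      exact ((continuous_apply (e i : Fin n)).comp continuous_subtype_val).div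
        ((continuous_apply j).comp continuous_subtype_val)
        fun z => apply_ne_zero_of_indispensable hj z.2)

end Quotients

end LVMB

theorem proposition5p2 (m n k : ℕ) (E : LVMB.FundamentalSet (2 * m + 1) n)
    (l : Fin n → Fin m → ℂ) (hgood : LVMB.IsGoodSystem E l)
    (htype : E.indispensable.ncard = k) (hk : 0 < k) :
    (∃ j, j ∈ E.indispensable) ∧
    ∀ j ∈ E.indispensable, ∀ e : Fin (n - 1) ≃ {i : Fin n // i ≠ j},
      ∃ (Ψ : LVMB.DiagonalQuotient E.associatedComplex ≃ₜ LVMB.OrbitSpace E l)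
        (Φ : LVMB.OrbitSpace E l ≃ₜ
          LVMB.momentAngle (E.associatedComplex.comap
            (e.toEmbedding.trans (Function.Embedding.subtype _)))),
        (∀ z : LVMB.momentAngle E.associatedComplex,
          Ψ (Quotient.mk (LVMB.diagonalSetoid E.associatedComplex) z) =
            LVMB.proj E l (LVMB.incl E z)) ∧
        ∀ (z : LVMB.momentAngle E.associatedComplex) (i : Fin (n - 1)),
          (Φ (LVMB.proj E l (LVMB.incl E z))).1 i = z.1 (e i) / z.1 j := by

  have := hgood.compact
  have := hgood.hausdorff
  refine ⟨Set.nonempty_of_ncard_ne_zero (htype ▸ hk.ne'), fun j hj e => ?_⟩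
  let Ψ := LVMB.diagonalQuotientHomeomorph hgood.acceptable
  refine ⟨Ψ, Ψ.symm.trans (LVMB.diagonalQuotientHomeomorphComap e hj), fun z => rfl, fun z i => ?_⟩
  have h : Ψ.symm (LVMB.proj E l (LVMB.incl E z)) =
      Quotient.mk (LVMB.diagonalSetoid E.associatedComplex) z :=
    Ψ.symm_apply_eq.2 rfl
  rw [Homeomorph.trans_apply, h]
  rfl
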